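/- Work in base $b=4$. For $v\in\mathbb N=\{0,1,2,\dots\}$ let $s(v)$ be the sum of the base-$4$ digits of $v$, and let $F(u)$ be the number of $v\in\mathbb N$ with $v+s(v)=u$. For $n\ge 1$ let $K(n)$ be the smallest $u\in\mathbb N$ with $F(u)=n$, and for $i\in\{0,1,2\}$ let $K_i(n)$ be the smallest $u\in\mathbb N$ with $F(u)=n$ and $u\equiv i\pmod 3$. Let $\tau(n)\in\{0,1,2\}$ be the index with $K(n)=K_{\tau(n)}(n)$. For $n\ge2$ let $B(n)+1$ be the number of base-$4$ digits of $K(n)$, and let $\mathcal B(n)=4^{B(n)}+1$. For $m\ge 2$, $O_{\mathcal B}(m)$ stands for a number of the form $\alpha_1\mathcal B(n_1)+\dots+\alpha_t\mathcal B(n_t)+K_\beta(1)$ with $t\ge1$, $n_1=m$, $\alpha_j\in\{1,2,3\}$, $\beta\in\{0,1,2\}$, $n_1>\dots>n_t$, $n_j\in\{\lfloor n_{j-1}/2\rfloor,\lceil n_{j-1}/2\rceil\}$ for $2\le j\le t$, and $n_t\in\{2,3\}$; and $O_{\mathcal B}(1)$ stands for a number $K_\beta(1)$ with $\beta\in\{0,1,2\}$.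 **Theorem.** Let $d\ge0$ and $n$ be integers. (i) If $\frac{10\cdot4^d+2}{3}\le n<\frac{20\cdot4^d+1}{3}$, put $m=\lceil n/4\rceil$ if $d\ge1$ and $n=\frac{20\cdot4^d-2}{3}$, and $m=\lfloor n/4\rfloor$ otherwise. Then $$\begin{aligned}K_0(n)&=2\mathcal B(n)+\mathcal B(\lfloor n/2\rfloor)+O_{\mathcal B}(m),\\ K_1(n)&=\mathcal B(n)+\mathcal B(\lfloor n/2\rfloor)+O_{\mathcal B}(m),\\ K_2(n)&=3\mathcal B(n)+\mathcal B(\lfloor n/2\rfloor)+O_{\mathcal B}(m),\end{aligned}$$ and $\tau(n)=1$. (ii) If $\frac{20\cdot4^d+1}{3}\le n<\frac{10\cdot4^{d+1}-1}{3}$, put $a=1$ if $n=\frac{20\cdot4^d+1}{3}$ and $a=2$ otherwise, and $m=2$ if $n=7$ and $m=\lfloor n/4\rfloor$ otherwise. Then $$\begin{aligned}K_0(n)&=\mathcal B(n)+\mathcal B(\lceil n/2\rceil)+O_{\mathcal B}(\lfloor (n+1)/4\rfloor),\\ K_1(n)&=2\mathcal B(n)+a\,\mathcal B(\lfloor n/2\rfloor)+O_{\mathcal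 B}(m),\\ K_2(n)&=\mathcal B(n)+a\,\mathcal B(\lfloor n/2\rfloor)+O_{\mathcal B}(m),\end{aligned}$$ and $\tau(n)=2$ if $n$ is odd, $\tau(n)=0$ if $n$ is even. (iii) If $n=\frac{10\cdot4^{d+1}-1}{3}$, then $$\begin{aligned}K_0(n)&=\mathcal B(n)+\mathcal B(\lfloor n/2\rfloor)+O_{\mathcal B}(\lfloor n/4\rfloor),\\ K_1(n)&=2\mathcal B(n)+\mathcal B(\lceil n/2\rceil)+O_{\mathcal B}(\lceil n/4\rceil),\\ K_2(n)&=\mathcal B(n)+\mathcal B(\lceil n/2\rceil)+O_{\mathcal B}(\lceil n/4\rceil),\end{aligned}$$ and $\tau(n)=0$. Consequently, with $\delta_j=\frac{10\cdot4^j-1}{3}$, the sequence $\tau(1),\tau(2),\tau(3),\dots$ consists of the three terms $0,2,2$ followed, for $j=0,1,2,\dots$ in this order, by the blocks $1^{\delta_j},(2,0)^{\delta_j},0$ (here $w^{k}$ is $k$ consecutive copies of $w$). -/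

import Mathlib

namespace Kaprekar

/-- `f v = v + s v`, where `s v` is the sum of the base-`b` digits of `v`. -/
def f (b v : ℕ) : ℕ := v + (Nat.digits b v).sum

/-- The number of generators of `u` (a finite number, since `f b v = u` forces `v ≤ u`). -/
noncomputable def F (b u : ℕ) : ℕ := {v : ℕ | f b v = u}.ncard

/-- The smallest number with exactly `n` generators. -/
noncomputable def K (b n : ℕ) : ℕ := sInf {u : ℕ | F b u = n}

/-- The smallest number congruent to `i` modulo `b - 1` with exactly `n` generators. -/
noncomputable def Ki (b i n : ℕ) : ℕ := sInf {u : ℕ | F b u = n ∧ u ≡ i [MOD (b - 1)]}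

/-- The exponent of the leading power of `b` in `K b n`: the number `K b n` has `B b n + 1`
base-`b` digits. -/
noncomputable def B (b n : ℕ) : ℕ := Nat.log b (K b n)

/-- The quasi-positional unit `b ^ B(n) + 1`. -/
noncomputable def cB (b n : ℕ) : ℕ := b ^ B b n + 1

/-- The index set of residues modulo `b - 1`: all of `0, …, b - 2` for even `b`, the even ones
for odd `b`. -/
def idx (b : ℕ) : Set ℕ := {i | i < b - 1 ∧ (Odd b → Even i)}

/-- The generalized Thue–Morse sequence: for even `b` the `t ≤ b - 2` with `K(n) = K_t(n)`, for
odd `b` the `t ≤ (b - 3) / 2` with `K(n) = K_{2t}(n)`. There is only one such `t`, because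
the numbers `K_i(n)` lie in different residue classes. -/
noncomputable def tau (b n : ℕ) : ℕ :=
  sInf {t : ℕ | if Even b then t ∈ idx b ∧ K b n = Ki b t n
    else 2 * t ∈ idx b ∧ K b n = Ki b (2 * t) n}

/-- The conditions on a quasi-positional expansion
`α₁ 𝓑(n₁) + ⋯ + α_t 𝓑(n_t) + K_β(1)`, coded by the list `[(α₁, n₁), …, (α_t, n_t)]`
and by `β`. -/
structure IsQuasiRep (b : ℕ) (L : List (ℕ × ℕ)) (β : ℕ) : Prop where
  coeff : ∀ p ∈ L, 1 ≤ p.1 ∧ p.1 ≤ if Even b then b - 1 else (b - 1) / 2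
  residue : β ∈ idx b
  halving : L.IsChain fun p q => q.2 < p.2 ∧ (q.2 = p.2 / 2 ∨ q.2 = (p.2 + 1) / 2)
  last : ∀ p ∈ L.getLast?, p.2 = 2 ∨ p.2 = 3

/-- The value `α₁ 𝓑(n₁) + ⋯ + α_t 𝓑(n_t) + K_β(1)`. -/
noncomputable def repValue (b : ℕ) (L : List (ℕ × ℕ)) (β : ℕ) : ℕ :=
  (L.map fun p => p.1 * cB b p.2).sum + Ki b β 1

/-- The leading index `n₁`; an expansion without terms, that is `K_β(1)` alone, has leading
index `1`. -/
def leadIndex : List (ℕ × ℕ) → ℕ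
  | [] => 1
  | p :: _ => p.2

/-- The numbers denoted by `O_𝓑(m)`: the values of the quasi-positional expansions with leading
index `m`. -/
def OB (b m : ℕ) : Set ℕ :=
  {x | ∃ L β, IsQuasiRep b L β ∧ leadIndex L = m ∧ x = repValue b L β}

/-- `u = a₁ 𝓑(n₁) + a₂ 𝓑(n₂) + O_𝓑(m)`. -/
def HasLeadingTerms (b u a₁ n₁ a₂ n₂ m : ℕ) : Prop :=
  ∃ r ∈ OB b m, u = a₁ * cB b n₁ + a₂ * cB b n₂ + r

/-- `δ_j = (10 · 4 ^ j - 1) / 3`; the division is exact. -/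
def delta (j : ℕ) : ℕ := (10 * 4 ^ j - 1) / 3

/-- The word `1^{δ_j}, (2,0)^{δ_j}, 0`. -/
def block (j : ℕ) : List ℕ :=
  List.replicate (delta j) 1 ++ (List.replicate (delta j) [2, 0]).flatten ++ [0]

end Kaprekar

namespace Kaprekar

/-! ### Digit sums in base `4` -/

/-! Write `u = c (4 ^ k + 1) + r` with `1 ≤ c ≤ 3` and `r` small. A generator of `u` has leading
part `c` or `c - 1` before its last `k` digits. In the first case these digits form a generator of
`r`; in the second their complement is a generator of `r' = 3 k - 2 - r`. So `F u = F r + F r'`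
(`F_four_of_add`), and a least `u` with `n` generators calls for the least sum `r + r' ≡ 1` modulo
`3` with `F r + F r' = n`. The units `cB 4 n` grow almost sixteenfold or more from each index `n ≥
2` to the next, so only the balanced splitting of `n` is optimal. Splitting and growth are proved
together in `splits_and_growth`. Every `K_i(n)` is thus a multiple of `cB 4 n` plus some `K_j` of a
half of `n`.

It remains to find the optimal residues. Since `cB 4 n ≡ 2` modulo `3`, the pair `(2, 2)` gives
`K_0, K_1, K_2` the leading coefficients `2, 1, 3`; this makes `(0, 1)` the cheaper pair at the
doubled index. The pair `(0, 1)` gives coefficients `1, 2, 1`, which makes `(2, 2)` cheaper again.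
Hence the two patterns alternate on ranges that double (`splitting_pattern`). For odd `n` the larger
half decides, and a tie there is settled by lower terms; this produces the exceptional end of each
block. The value of `tau` is read off from the least leading coefficient, and from the tails when
two coefficients agree. -/

lemma digits_sum_eq (v : ℕ) :
    (Nat.digits 4 v).sum = v % 4 + (Nat.digits 4 (v / 4)).sum := by
  rcases Nat.eq_zero_or_pos v with rfl | hv
  · simp
  · rw [Nat.digits_def' (by norm_num) hv, List.sum_cons]

lemma digits_sum_leading (k c w : ℕ) (hc : c < 4) (hw : w < 4 ^ k) :
    (Nat.digits 4 (c * 4 ^ k + w)).sum = c + (Nat.digits 4 w).sum := by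
  induction k generalizing w with
  | zero =>
    obtain rfl : w = 0 := by simpa using hw
    rw [digits_sum_eq]
    simp [Nat.div_eq_of_lt hc, Nat.mod_eq_of_lt hc]
  | succ k ih =>
    rw [pow_succ] at hw ⊢
    rw [digits_sum_eq, digits_sum_eq w,
      show (c * (4 ^ k * 4) + w) / 4 = c * 4 ^ k + w / 4 by rw [← mul_assoc]; omega,
      show (c * (4 ^ k * 4) + w) % 4 = w % 4 by rw [← mul_assoc]; omega,
      ih (w / 4) (by omega)]
    omega

/-- Each of the `k` digits of `w'` is `3` minus the corresponding digit of `w`. -/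
lemma digits_sum_complement (k w w' : ℕ) (hw : w + w' + 1 = 4 ^ k) :
    (Nat.digits 4 w).sum + (Nat.digits 4 w').sum = 3 * k := by
  induction k generalizing w w' with
  | zero =>
    obtain ⟨rfl, rfl⟩ : w = 0 ∧ w' = 0 := by simpa using hw
    simp
  | succ k ih =>
    rw [pow_succ] at hw
    have := ih (w / 4) (w' / 4) (by omega)
    rw [digits_sum_eq w, digits_sum_eq w']
    omega

lemma le_f (b v : ℕ) : v ≤ f b v := Nat.le_add_right _ _

lemma f_four_leading (k c w : ℕ) (hc : c < 4) (hw : w < 4 ^ k) :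
    f 4 (c * 4 ^ k + w) = c * (4 ^ k + 1) + f 4 w := by
  unfold f
  rw [digits_sum_leading k c w hc hw]
  ring

lemma f_four_complement (k w w' : ℕ) (hw : w + w' + 1 = 4 ^ k) :
    f 4 w + f 4 w' + 1 = 4 ^ k + 3 * k := by
  have := digits_sum_complement k w w' hw
  unfold f
  omega

lemma lt_f_four {k v : ℕ} (hv : 4 ^ k ≤ v) : 4 ^ k < f 4 v := by
  rcases hv.lt_or_eq with h | rfl
  · exact h.trans_le (le_f 4 v)
  · have := f_four_leading k 1 0 (by norm_num) (by positivity)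
    simp only [one_mul, add_zero] at this
    omega

lemma three_mul_lt_four_pow (k : ℕ) (hk : 1 ≤ k) : 3 * k + 1 ≤ 4 ^ k := by
  induction k, hk using Nat.le_induction with
  | base => norm_num
  | succ k _ ih => rw [pow_succ]; omega

/-! ### The number of generators -/

lemma finite_generators (b u : ℕ) : {v | f b v = u}.Finite :=
  (Set.finite_Iic u).subset fun v hv => (le_f b v).trans (le_of_eq hv)

/-- Generators of `c (4 ^ k + 1) + r` have leading part `c` or `c - 1`. -/
lemma generators_four (k c r : ℕ) (hc : 1 ≤ c) (hc' : c ≤ 3) (hr : r ≤ 4 ^ k)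
    (hu : c * (4 ^ k + 1) + r ≤ 4 ^ (k + 1)) :
    {v | f 4 v = c * (4 ^ k + 1) + r} =
      (fun w => c * 4 ^ k + w) '' {w | f 4 w = r} ∪
      (fun w => c * 4 ^ k - 1 - w) '' {w | f 4 w + r + 2 = 3 * k} := by
  -- For `k = 0` the second set of generators is empty; otherwise its `w` satisfy `w ≤ 3 k - 2 < 4 ^
  -- k`, so they have a `k`-digit complement.
  have hk : k = 0 ∨ 3 * k + 1 ≤ 4 ^ k :=
    (Nat.eq_zero_or_pos k).imp_right (three_mul_lt_four_pow k)
  have hpos : 1 ≤ 4 ^ k := Nat.one_le_pow _ _ (by norm_num)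
  have hcX : 4 ^ k ≤ c * 4 ^ k := Nat.le_mul_of_pos_left _ hc
  have hsplit : c * 4 ^ k = (c - 1) * 4 ^ k + 4 ^ k := by
    obtain ⟨e, rfl⟩ : ∃ e, c = e + 1 := ⟨c - 1, by omega⟩
    simp; ring
  have hsplit' : c * (4 ^ k + 1) = (c - 1) * (4 ^ k + 1) + (4 ^ k + 1) := by
    obtain ⟨e, rfl⟩ : ∃ e, c = e + 1 := ⟨c - 1, by omega⟩
    simp; ring
  ext v
  simp only [Set.mem_ofPred_eq, Set.mem_union, Set.mem_image]
  constructor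
  · intro hv
    have hv4 : v < 4 ^ (k + 1) := by
      by_contra h
      have := lt_f_four (not_lt.1 h)
      omega
    rw [pow_succ] at hv4
    obtain ⟨d, w, hd, hw, rfl⟩ : ∃ d w, d < 4 ∧ w < 4 ^ k ∧ v = d * 4 ^ k + w :=
      ⟨v / 4 ^ k, v % 4 ^ k, by rw [Nat.div_lt_iff_lt_mul hpos]; omega,
        Nat.mod_lt _ hpos, (Nat.div_add_mod' _ _).symm⟩
    rw [f_four_leading k d w hd hw] at hv
    have hc1 := f_four_complement k w (4 ^ k - 1 - w) (by omega)
    have h1 := le_f 4 (4 ^ k - 1 - w)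
    rcases lt_trichotomy d c with h | rfl | h
    -- Since `f 4 w < 4 ^ k + 3 k`, the lower digits can make up for at most one missing unit `4 ^ k
    -- + 1`.
    · have hdc : d = c - 1 := by
        by_contra hne
        have : (d + 2) * (4 ^ k + 1) ≤ c * (4 ^ k + 1) := Nat.mul_le_mul_right _ (by omega)
        rw [add_mul] at this
        omega
      right
      rw [← hdc] at hsplit hsplit'
      exact ⟨4 ^ k - 1 - w, by omega, by omega⟩
    · exact Or.inl ⟨w, by omega, rfl⟩
    · have : (c + 1) * (4 ^ k + 1) ≤ d * (4 ^ k + 1) := Nat.mul_le_mul_right _ h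
      rw [add_mul] at this
      omega
  · rintro (⟨w, hw, rfl⟩ | ⟨w, hw, rfl⟩)
    · have hwk : w < 4 ^ k := by
        by_contra h
        have := lt_f_four (not_lt.1 h)
        omega
      rw [f_four_leading k c w (by omega) hwk, hw]
    · have h1 := le_f 4 w
      have h2 := f_four_complement k w (4 ^ k - 1 - w) (by omega)
      rw [show c * 4 ^ k - 1 - w = (c - 1) * 4 ^ k + (4 ^ k - 1 - w) by omega,
        f_four_leading k (c - 1) _ (by omega) (by omega)]
      omega

lemma disjoint_generators (k c r : ℕ) (hc : 1 ≤ c) :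
    Disjoint ((fun w => c * 4 ^ k + w) '' {w | f 4 w = r})
      ((fun w => c * 4 ^ k - 1 - w) '' {w | f 4 w + r + 2 = 3 * k}) := by
  rw [Set.disjoint_left]
  rintro _ ⟨w, -, rfl⟩ ⟨w', -, h⟩
  have : 1 ≤ c * 4 ^ k := Nat.mul_pos hc (by positivity)
  simp only at h
  omega

lemma F_four_of_add (k c r r' : ℕ) (hc : 1 ≤ c) (hc' : c ≤ 3) (hr : r + r' + 2 = 3 * k) :
    F 4 (c * (4 ^ k + 1) + r) = F 4 r + F 4 r' := by
  have hk := three_mul_lt_four_pow k (by omega)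
  have hcX : c * (4 ^ k + 1) ≤ 3 * (4 ^ k + 1) := Nat.mul_le_mul_right _ hc'
  have hset : {w | f 4 w + r + 2 = 3 * k} = {w | f 4 w = r'} := by
    ext w; simp only [Set.mem_ofPred_eq]; omega
  unfold F
  rw [generators_four k c r hc hc' (by omega) (by rw [pow_succ]; omega),
    Set.ncard_union_eq (disjoint_generators k c r hc) ((finite_generators 4 r).image _)
      (by rw [hset]; exact (finite_generators 4 r').image _), hset,
    Set.ncard_image_of_injective _ (add_right_injective _), Set.InjOn.ncard_image]
  intro x hx y hy hxy
  have h1 := le_f 4 x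
  have h2 := le_f 4 y
  have : 4 ^ k ≤ c * 4 ^ k := Nat.le_mul_of_pos_left _ hc
  simp only [Set.mem_ofPred_eq] at hx hy hxy
  omega

/-- Here `3 k - 2 - r` would be negative, so leading part `c - 1` contributes nothing. -/
lemma F_four_of_lt (k c r : ℕ) (hc : 1 ≤ c) (hc' : c ≤ 3) (hr : r ≤ 4 ^ k)
    (hu : c * (4 ^ k + 1) + r ≤ 4 ^ (k + 1)) (hkr : 3 * k < r + 2) :
    F 4 (c * (4 ^ k + 1) + r) = F 4 r := by
  have hset : {w | f 4 w + r + 2 = 3 * k} = ∅ := by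
    ext w; simp only [Set.mem_ofPred_eq, Set.mem_empty_iff_false, iff_false]; omega
  unfold F
  rw [generators_four k c r hc hc' hr hu, hset, Set.image_empty, Set.union_empty,
    Set.ncard_image_of_injective _ (add_right_injective _)]

/-- Every `u ≥ 2` has the form treated by `F_four_of_add` and `F_four_of_lt`. -/
lemma exists_leading (u : ℕ) (hu : 2 ≤ u) : ∃ k c r, 1 ≤ c ∧ c ≤ 3 ∧ r ≤ 4 ^ k ∧
    c * (4 ^ k + 1) + r ≤ 4 ^ (k + 1) ∧ u = c * (4 ^ k + 1) + r := by
  -- The logarithm is taken of `u - 1` because the unit is `4 ^ k + 1`: the power `4 ^ k` itself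
  -- belongs to the previous exponent.
  set k := Nat.log 4 (u - 1)
  have h1 : 4 ^ k ≤ u - 1 := Nat.pow_log_le_self 4 (by omega)
  have h2 : u - 1 < 4 ^ (k + 1) := Nat.lt_pow_succ_log_self (by norm_num) _
  have h3 := Nat.div_add_mod' u (4 ^ k + 1)
  have h4 := Nat.mod_lt u (show 0 < 4 ^ k + 1 by positivity)
  refine ⟨k, u / (4 ^ k + 1), u % (4 ^ k + 1), ?_, ?_, by omega, by omega, h3.symm⟩
  · rw [Nat.le_div_iff_mul_le (by positivity)]; omega
  · rw [pow_succ] at h2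
    exact Nat.le_of_lt_succ (by rw [Nat.div_lt_iff_lt_mul (by positivity)]; omega)

lemma F_zero : F 4 0 = 1 := by
  have : {v | f 4 v = 0} = {0} := by
    ext v
    simp only [Set.mem_ofPred_eq, Set.mem_singleton_iff]
    constructor
    · intro h; have := le_f 4 v; omega
    · rintro rfl; simp [f]
  rw [F, this, Set.ncard_singleton]

lemma F_one : F 4 1 = 0 := by
  have : {v | f 4 v = 1} = ∅ := by
    ext v
    simp only [Set.mem_ofPred_eq, Set.mem_empty_iff_false, iff_false]
    intro h
    have := le_f 4 v
    obtain rfl | rfl : v = 0 ∨ v = 1 := by omega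
    all_goals simp [f] at h
  rw [F, this, Set.ncard_empty]

lemma F_two : F 4 2 = 1 := by
  simpa [F_zero] using F_four_of_lt 0 1 0 (by norm_num) (by norm_num) (by norm_num)
    (by norm_num) (by norm_num)

lemma F_four : F 4 4 = 1 := by
  simpa [F_zero] using F_four_of_lt 0 2 0 (by norm_num) (by norm_num) (by norm_num)
    (by norm_num) (by norm_num)
/-! ### Least numbers with a given number of generators -/

/-- Every residue class modulo `3` contains a number with exactly `n` generators. -/
def Attained (n : ℕ) : Prop := ∀ i < 3, ∃ u, F 4 u = n ∧ u % 3 = i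

lemma Ki_le {n u i : ℕ} (hu : F 4 u = n) (hi : u % 3 = i) : Ki 4 i n ≤ u :=
  Nat.sInf_le ⟨hu, by subst hi; exact (Nat.mod_modEq u 3).symm⟩

lemma Attained.Ki_mem {n i : ℕ} (h : Attained n) (hi : i < 3) :
    F 4 (Ki 4 i n) = n ∧ Ki 4 i n % 3 = i := by
  obtain ⟨u, hu, hui⟩ := h i hi
  have hne : {u : ℕ | F 4 u = n ∧ u ≡ i [MOD (4 - 1)]}.Nonempty :=
    ⟨u, hu, by subst hui; exact (Nat.mod_modEq u 3).symm⟩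
  obtain ⟨h1, h2⟩ := Nat.sInf_mem hne
  exact ⟨h1, Eq.trans h2 (Nat.mod_eq_of_lt hi)⟩

lemma K_le {n u : ℕ} (hu : F 4 u = n) : K 4 n ≤ u := Nat.sInf_le hu

lemma Attained.F_K {n : ℕ} (h : Attained n) : F 4 (K 4 n) = n := by
  obtain ⟨u, hu, -⟩ := h 0 (by norm_num)
  exact Nat.sInf_mem (s := {u | F 4 u = n}) ⟨u, hu⟩

lemma Attained.K_eq_Ki {n : ℕ} (h : Attained n) : K 4 n = Ki 4 (K 4 n % 3) n :=
  le_antisymm (K_le (h.Ki_mem (Nat.mod_lt _ (by norm_num))).1) (Ki_le h.F_K rfl)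

/-- The least sum `r + r' ≡ 1` modulo `3` of numbers with `⌊n/2⌋` and `⌈n/2⌉` generators. -/
noncomputable def minSum (n : ℕ) : ℕ :=
  min (min (Ki 4 0 (n / 2) + Ki 4 1 ((n + 1) / 2)) (Ki 4 1 (n / 2) + Ki 4 0 ((n + 1) / 2)))
    (Ki 4 2 (n / 2) + Ki 4 2 ((n + 1) / 2))

/-- The residues `i`, `j` modulo `3` yield an optimal splitting of `n`. -/
structure IsOptimal (n i j : ℕ) : Prop where
  left_lt : i < 3
  right_lt : j < 3
  add_mod : (i + j) % 3 = 1
  eq_minSum : Ki 4 i (n / 2) + Ki 4 j ((n + 1) / 2) = minSum n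

lemma minSum_le (n : ℕ) {i j : ℕ} (hi : i < 3) (hj : j < 3) (hij : (i + j) % 3 = 1) :
    minSum n ≤ Ki 4 i (n / 2) + Ki 4 j ((n + 1) / 2) := by
  unfold minSum
  obtain ⟨rfl, rfl⟩ | ⟨rfl, rfl⟩ | ⟨rfl, rfl⟩ :
    (i = 0 ∧ j = 1) ∨ (i = 1 ∧ j = 0) ∨ (i = 2 ∧ j = 2) := by omega
  all_goals omega

lemma exists_isOptimal (n : ℕ) : ∃ i j, IsOptimal n i j := by
  have h : minSum n = Ki 4 0 (n / 2) + Ki 4 1 ((n + 1) / 2) ∨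
      minSum n = Ki 4 1 (n / 2) + Ki 4 0 ((n + 1) / 2) ∨
      minSum n = Ki 4 2 (n / 2) + Ki 4 2 ((n + 1) / 2) := by
    unfold minSum; omega
  rcases h with h | h | h
  · exact ⟨0, 1, by norm_num, by norm_num, by norm_num, h.symm⟩
  · exact ⟨1, 0, by norm_num, by norm_num, by norm_num, h.symm⟩
  · exact ⟨2, 2, by norm_num, by norm_num, by norm_num, h.symm⟩

/-- The numbers with `n` generators up to `4 ^ (B(n) + 1)` come from the optimal splittings
of `n`. -/
structure Splits (n : ℕ) : Prop where
  attained : Attained n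
  attained_left : Attained (n / 2)
  attained_right : Attained ((n + 1) / 2)
  minSum_add : minSum n + 2 = 3 * B 4 n
  lower : ∀ u, F 4 u = n → 4 ^ B 4 n + 1 ≤ u
  rep : ∀ u, F 4 u = n → u ≤ 4 ^ (B 4 n + 1) → ∃ c i j, 1 ≤ c ∧ c ≤ 3 ∧ IsOptimal n i j ∧
    (u = c * cB 4 n + Ki 4 i (n / 2) ∨ u = c * cB 4 n + Ki 4 j ((n + 1) / 2))

/-- If two numbers have `n` generators in total, both have some, and their sum is at most
`minSum n`, then they form an optimal splitting. -/
lemma exists_isOptimal_of_add_le {n r r' : ℕ}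
    (hm : ∀ m, (n + 1) / 2 < m → m < n → ∀ r, F 4 r = m → minSum n < r)
    (hF : F 4 r + F 4 r' = n) (hr : 1 ≤ F 4 r) (hr' : 1 ≤ F 4 r')
    (hmod : (r + r') % 3 = 1) (hle : r + r' ≤ minSum n) :
    r + r' = minSum n ∧ ∃ i j, IsOptimal n i j ∧ (r = Ki 4 i (n / 2) ∨ r = Ki 4 j ((n + 1) / 2)) := by
  have h1 : F 4 r ≤ (n + 1) / 2 := by
    by_contra h
    have := hm (F 4 r) (by omega) (by omega) r rfl
    omega
  have h2 : F 4 r' ≤ (n + 1) / 2 := by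
    by_contra h
    have := hm (F 4 r') (by omega) (by omega) r' rfl
    omega
  have hi := Nat.mod_lt r (show 3 > 0 by norm_num)
  have hj := Nat.mod_lt r' (show 3 > 0 by norm_num)
  obtain ⟨ha, hb⟩ | ⟨ha, hb⟩ : (F 4 r = n / 2 ∧ F 4 r' = (n + 1) / 2) ∨
      (F 4 r = (n + 1) / 2 ∧ F 4 r' = n / 2) := by omega
  · have k1 := Ki_le ha rfl
    have k2 := Ki_le hb rfl
    have k3 := minSum_le n hi hj (by omega)
    exact ⟨by omega, _, _, ⟨hi, hj, by omega, by omega⟩, Or.inl (by omega)⟩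
  · have k1 := Ki_le ha rfl
    have k2 := Ki_le hb rfl
    have k3 := minSum_le n hj hi (by omega)
    exact ⟨by omega, _, _, ⟨hj, hi, by omega, by omega⟩, Or.inr (by omega)⟩

/-- Descent on `u`: if all generators come from `r` alone or from `r'` alone, a smaller number
already has `n` generators. Otherwise both contribute, and an exponent below `k` would make `r + r'`
smaller than `minSum n`. -/
lemma lower_of_minSum {n k : ℕ} (hn : 2 ≤ n) (hk : minSum n + 2 = 3 * k)
    (hm : ∀ m, (n + 1) / 2 < m → m < n → ∀ r, F 4 r = m → minSum n < r) (u : ℕ)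
    (hu : F 4 u = n) : 4 ^ k + 1 ≤ u := by
  induction u using Nat.strong_induction_on with
  | _ u ih =>
    have hu2 : 2 ≤ u := by
      by_contra h
      obtain rfl | rfl : u = 0 ∨ u = 1 := by omega
      · rw [F_zero] at hu; omega
      · rw [F_one] at hu; omega
    obtain ⟨k', c, r, hc, hc', hr, hle, rfl⟩ := exists_leading u hu2
    have hcX : 4 ^ k' + 1 ≤ c * (4 ^ k' + 1) := Nat.le_mul_of_pos_left _ hc
    rcases lt_or_ge (3 * k') (r + 2) with h | h
    · rw [F_four_of_lt k' c r hc hc' hr hle h] at hu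
      have := ih r (by omega) hu
      omega
    · obtain ⟨r', hr'⟩ : ∃ r', r + r' + 2 = 3 * k' := ⟨3 * k' - 2 - r, by omega⟩
      rw [F_four_of_add k' c r r' hc hc' hr'] at hu
      have h3 := three_mul_lt_four_pow k (by omega)
      have h3' := three_mul_lt_four_pow k' (by omega)
      suffices hkk : k ≤ k' by
        have := Nat.pow_le_pow_right (n := 4) (by norm_num) hkk
        omega
      rcases Nat.eq_zero_or_pos (F 4 r) with h0 | h0
      · have := ih r' (by omega) (by omega)
        omega
      rcases Nat.eq_zero_or_pos (F 4 r') with h0' | h0'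
      · have := ih r (by omega) (by omega)
        omega
      by_contra hlt
      have := (exists_isOptimal_of_add_le hm hu h0 h0' (by omega) (by omega)).1
      omega

lemma splits_of_attained {n : ℕ} (hn : 2 ≤ n) (ha : Attained (n / 2))
    (hb : Attained ((n + 1) / 2))
    (hm : ∀ m, (n + 1) / 2 < m → m < n → ∀ r, F 4 r = m → minSum n < r) : Splits n := by
  obtain ⟨i, j, hopt⟩ := exists_isOptimal n
  obtain ⟨hi, hj, hij, hsum⟩ := hopt
  obtain ⟨hFa, hma⟩ := ha.Ki_mem hi
  obtain ⟨hFb, hmb⟩ := hb.Ki_mem hj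
  obtain ⟨k, hk⟩ : ∃ k, minSum n + 2 = 3 * k := ⟨(minSum n + 2) / 3, by omega⟩
  have hlow := lower_of_minSum hn hk hm
  have h3 := three_mul_lt_four_pow k (by omega)
  have hF : ∀ c, 1 ≤ c → c ≤ 3 → F 4 (c * (4 ^ k + 1) + Ki 4 i (n / 2)) = n := by
    intro c hc hc'
    rw [F_four_of_add k c _ (Ki 4 j ((n + 1) / 2)) hc hc' (by omega), hFa, hFb]
    omega
  have hatt : Attained n := by
    intro t ht
    have hp : 4 ^ k % 3 = 1 := by simp [Nat.pow_mod]
    -- As `4 ^ k + 1 ≡ 2` modulo `3`, the three leading coefficients reach all three residues.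
    obtain ⟨c, hc, hc', hct⟩ : ∃ c, 1 ≤ c ∧ c ≤ 3 ∧ (2 * c + i) % 3 = t := by
      obtain h | h | h : (2 * 1 + i) % 3 = t ∨ (2 * 2 + i) % 3 = t ∨ (2 * 3 + i) % 3 = t := by omega
      exacts [⟨1, by norm_num, by norm_num, h⟩, ⟨2, by norm_num, by norm_num, h⟩,
        ⟨3, by norm_num, by norm_num, h⟩]
    refine ⟨_, hF c hc hc', ?_⟩
    have h1 : c = 1 ∨ c = 2 ∨ c = 3 := by omega
    rcases h1 with rfl | rfl | rfl <;> omega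
  have hB : B 4 n = k := by
    have h1 := hlow _ hatt.F_K
    have h2 := K_le (hF 1 le_rfl (by norm_num))
    exact Nat.log_eq_of_pow_le_of_lt_pow (by omega) (by rw [pow_succ]; omega)
  refine ⟨hatt, ha, hb, by rw [hB, hk], by rwa [hB], fun u hu hle => ?_⟩
  rw [cB, hB] at *
  have hlu := hlow u hu
  obtain ⟨k', c, r, hc, hc', hr, hle', rfl⟩ := exists_leading u (by omega)
  have hcX : 4 ^ k' + 1 ≤ c * (4 ^ k' + 1) := Nat.le_mul_of_pos_left _ hc
  obtain rfl : k' = k := by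
    have h1 : k' < k + 1 := (Nat.pow_lt_pow_iff_right (a := 4) (by norm_num)).1 (by omega)
    have h2 : k < k' + 1 := (Nat.pow_lt_pow_iff_right (a := 4) (by norm_num)).1 (by omega)
    omega
  rcases lt_or_ge (3 * k') (r + 2) with h | h
  · rw [F_four_of_lt k' c r hc hc' hr hle h] at hu
    have := hlow r hu
    omega
  · obtain ⟨r', hr'⟩ : ∃ r', r + r' + 2 = 3 * k' := ⟨3 * k' - 2 - r, by omega⟩
    rw [F_four_of_add k' c r r' hc hc' hr'] at hu
    rcases Nat.eq_zero_or_pos (F 4 r) with h0 | h0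
    · have := hlow r' (by omega)
      omega
    rcases Nat.eq_zero_or_pos (F 4 r') with h0' | h0'
    · have := hlow r (by omega)
      omega
    obtain ⟨-, i, j, hopt, h⟩ := exists_isOptimal_of_add_le hm hu h0 h0' (by omega) (by omega)
    exact ⟨c, i, j, hc, hc', hopt, by omega⟩

/-! ### Consequences of the splitting -/

lemma cB_mod_three (n : ℕ) : cB 4 n % 3 = 2 := by
  have hp : 4 ^ B 4 n % 3 = 1 := by simp [Nat.pow_mod]
  unfold cB
  omega

namespace Splits

lemma one_le_B {n : ℕ} (h : Splits n) : 1 ≤ B 4 n := by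
  have := h.minSum_add
  omega

lemma F_left {n : ℕ} (h : Splits n) {c i j : ℕ} (hc : 1 ≤ c) (hc' : c ≤ 3) (ho : IsOptimal n i j) :
    F 4 (c * cB 4 n + Ki 4 i (n / 2)) = n := by
  have h1 := h.minSum_add
  have h2 := ho.eq_minSum
  rw [cB, F_four_of_add _ c _ (Ki 4 j ((n + 1) / 2)) hc hc' (by omega),
    (h.attained_left.Ki_mem ho.left_lt).1, (h.attained_right.Ki_mem ho.right_lt).1]
  omega

lemma F_right {n : ℕ} (h : Splits n) {c i j : ℕ} (hc : 1 ≤ c) (hc' : c ≤ 3) (ho : IsOptimal n i j) :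
    F 4 (c * cB 4 n + Ki 4 j ((n + 1) / 2)) = n := by
  have h1 := h.minSum_add
  have h2 := ho.eq_minSum
  rw [cB, F_four_of_add _ c _ (Ki 4 i (n / 2)) hc hc' (by omega),
    (h.attained_left.Ki_mem ho.left_lt).1, (h.attained_right.Ki_mem ho.right_lt).1]
  omega

lemma cB_le_Ki {n : ℕ} (h : Splits n) {i : ℕ} (hi : i < 3) : cB 4 n ≤ Ki 4 i n :=
  h.lower _ (h.attained.Ki_mem hi).1

lemma Ki_le_pow {n : ℕ} (h : Splits n) {i : ℕ} (hi : i < 3) : Ki 4 i n ≤ 4 ^ (B 4 n + 1) := by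
  obtain ⟨a, b, ho⟩ := exists_isOptimal n
  have h1 := h.minSum_add
  have h2 := ho.eq_minSum
  have h3 := three_mul_lt_four_pow _ h.one_le_B
  have hm := (h.attained_left.Ki_mem ho.left_lt).2
  have hA := cB_mod_three n
  have hA' : cB 4 n = 4 ^ B 4 n + 1 := rfl
  obtain hc | hc | hc : (1 * cB 4 n + Ki 4 a (n / 2)) % 3 = i ∨
      (2 * cB 4 n + Ki 4 a (n / 2)) % 3 = i ∨ (3 * cB 4 n + Ki 4 a (n / 2)) % 3 = i := by omega
  all_goals
    have := Ki_le (h.F_left (by norm_num) (by norm_num) ho) hc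
    rw [pow_succ]
    omega

lemma Ki_lt {n : ℕ} (h : Splits n) {i : ℕ} (hi : i < 3) : Ki 4 i n + 4 ≤ 4 * cB 4 n := by
  have := h.Ki_le_pow hi
  rw [pow_succ] at this
  unfold cB
  omega

/-- Without a prescribed residue the coefficient `1` is available. This sharpens `Ki_lt` enough for
`minSum_growth_odd`. -/
lemma K_le_add {n : ℕ} (h : Splits n) : K 4 n + 1 ≤ cB 4 n + 3 * B 4 n := by
  obtain ⟨a, b, ho⟩ := exists_isOptimal n
  have h1 := h.minSum_add
  have h2 := ho.eq_minSum
  have := K_le (h.F_left le_rfl (by norm_num) ho)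
  omega

/-- The least numbers have a leading multiple of `𝓑(n)`, followed by a least number for one of
the two halves of `n`. -/
lemma exists_Ki_eq {n : ℕ} (h : Splits n) {i : ℕ} (hi : i < 3) : ∃ c a b, 1 ≤ c ∧ c ≤ 3 ∧ IsOptimal n a b ∧
    (Ki 4 i n = c * cB 4 n + Ki 4 a (n / 2) ∨ Ki 4 i n = c * cB 4 n + Ki 4 b ((n + 1) / 2)) :=
  h.rep _ (h.attained.Ki_mem hi).1 (h.Ki_le_pow hi)

end Splits
/-! ### The first values -/

lemma attained_one : Attained 1 := by
  intro i hi
  obtain rfl | rfl | rfl : i = 0 ∨ i = 1 ∨ i = 2 := by omega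
  exacts [⟨0, F_zero, rfl⟩, ⟨4, F_four, rfl⟩, ⟨2, F_two, rfl⟩]

lemma Ki_zero_one : Ki 4 0 1 = 0 := Nat.le_zero.1 (Ki_le F_zero rfl)

lemma Ki_one_one : Ki 4 1 1 = 4 := by
  have h1 := Ki_le F_four (i := 1) rfl
  obtain ⟨h2, h3⟩ := attained_one.Ki_mem (i := 1) (by norm_num)
  have h4 : Ki 4 1 1 ≠ 1 := by
    intro h
    rw [h, F_one] at h2
    omega
  omega

lemma Ki_two_one : Ki 4 2 1 = 2 := by
  have h1 := Ki_le F_two (i := 2) rfl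
  have h3 := (attained_one.Ki_mem (i := 2) (by norm_num)).2
  omega

lemma splits_two : Splits 2 :=
  splits_of_attained le_rfl attained_one attained_one (by omega)

lemma minSum_two : minSum 2 = 4 := by
  simp [minSum, Ki_zero_one, Ki_one_one, Ki_two_one]

lemma B_two : B 4 2 = 2 := by
  have := splits_two.minSum_add
  rw [minSum_two] at this
  omega

lemma cB_two : cB 4 2 = 17 := by rw [cB, B_two]; norm_num

lemma Ki_two_cases {i : ℕ} (hi : i < 3) : ∃ c a, 1 ≤ c ∧ a < 3 ∧ Ki 4 i 2 = c * 17 + Ki 4 a 1 := by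
  obtain ⟨c, a, b, hc, -, ho, h⟩ := splits_two.exists_Ki_eq hi
  rw [cB_two] at h
  rcases h with h | h
  exacts [⟨c, a, hc, ho.left_lt, h⟩, ⟨c, b, hc, ho.right_lt, h⟩]

lemma Ki_two (i : ℕ) (hi : i < 3) : Ki 4 i 2 = 21 - 2 * i := by
  have e := minSum_two
  have h0 := Ki_zero_one
  have h1 := Ki_one_one
  have h2 := Ki_two_one
  have o0 : IsOptimal 2 0 1 := ⟨by norm_num, by norm_num, by norm_num, by simp [e, h0, h1]⟩
  have o2 : IsOptimal 2 2 2 := ⟨by norm_num, by norm_num, by norm_num, by simp [e, h2]⟩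
  have f0 := splits_two.F_left le_rfl (by norm_num) o0
  have f1 := splits_two.F_right le_rfl (by norm_num) o0
  have f2 := splits_two.F_left le_rfl (by norm_num) o2
  simp only [cB_two, Nat.reduceDiv, Nat.reduceAdd, h0, h1, h2, one_mul] at f0 f1 f2
  obtain ⟨c, a, hc, ha, h⟩ := Ki_two_cases hi
  have hmod := (splits_two.attained.Ki_mem hi).2
  have ha' : Ki 4 a 1 % 3 = a := (attained_one.Ki_mem ha).2
  obtain rfl | rfl | rfl : i = 0 ∨ i = 1 ∨ i = 2 := by omega
  · have := Ki_le f1 (i := 0) rfl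
    obtain rfl | rfl | rfl : a = 0 ∨ a = 1 ∨ a = 2 := by omega
    all_goals omega
  · have := Ki_le f2 (i := 1) rfl
    obtain rfl | rfl | rfl : a = 0 ∨ a = 1 ∨ a = 2 := by omega
    all_goals omega
  · have := Ki_le f0 (i := 2) rfl
    obtain rfl | rfl | rfl : a = 0 ∨ a = 1 ∨ a = 2 := by omega
    all_goals omega

lemma splits_three : Splits 3 :=
  splits_of_attained (by norm_num) attained_one splits_two.attained (by omega)

lemma minSum_three : minSum 3 = 19 := by
  simp [minSum, Ki_zero_one, Ki_one_one, Ki_two_one, Ki_two]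

lemma B_three : B 4 3 = 7 := by
  have := splits_three.minSum_add
  rw [minSum_three] at this
  omega

lemma cB_three : cB 4 3 = 16385 := by rw [cB, B_three]; norm_num

/-! ### All indices split, and the exponents grow -/

lemma Splits.cB_add_le_minSum {n : ℕ} (ha : Splits (n / 2)) (hb : Splits ((n + 1) / 2)) :
    cB 4 (n / 2) + cB 4 ((n + 1) / 2) ≤ minSum n := by
  obtain ⟨i, j, ho⟩ := exists_isOptimal n
  have := ha.cB_le_Ki ho.left_lt
  have := hb.cB_le_Ki ho.right_lt
  have := ho.eq_minSum
  omega

lemma cB_growth {m n : ℕ} (h : B 4 m + 2 ≤ B 4 n) : 16 * cB 4 m ≤ cB 4 n + 15 := by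
  have := Nat.pow_le_pow_right (n := 4) (by norm_num) h
  rw [pow_add] at this
  unfold cB
  omega

lemma two_le_cB (n : ℕ) : 2 ≤ cB 4 n := by
  have := Nat.one_le_pow (B 4 n) 4 (by norm_num)
  unfold cB
  omega

lemma six_mul_add_le_four_pow (k : ℕ) (hk : 2 ≤ k) : 6 * k + 4 ≤ 4 ^ k := by
  induction k, hk using Nat.le_induction with
  | base => norm_num
  | succ k _ ih => rw [pow_succ]; omega

/-- The sum `2 K_2(h)` stays below `8 cB 4 h`, while the next minimum contains `cB 4 (h + 1)`. A gap
of `6` in `minSum` is a gap of `2` in the exponent. -/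
lemma minSum_growth_even {h : ℕ} (hs : Splits h) (hs' : Splits (h + 1))
    (hB : B 4 h + 2 ≤ B 4 (h + 1)) : minSum (2 * h) + 6 ≤ minSum (2 * h + 1) := by
  have e1 : 2 * h / 2 = h := by omega
  have e2 : (2 * h + 1) / 2 = h := by omega
  have e3 : (2 * h + 1 + 1) / 2 = h + 1 := by omega
  have h1 := minSum_le (2 * h) (i := 2) (j := 2) (by norm_num) (by norm_num) (by norm_num)
  have h2 := Splits.cB_add_le_minSum (n := 2 * h + 1) (by rwa [e2]) (by rwa [e3])
  rw [e1, e2] at h1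
  rw [e2, e3] at h2
  have h3 := hs.Ki_lt (i := 2) (by norm_num)
  have h4 := cB_growth hB
  have h5 := two_le_cB h
  omega

/-- Both minima involve index `h + 1`, once and twice. So the single term must be close to `cB 4 (h
+ 1)`: it is taken to be `K 4 (h + 1)`, and the residue at `h` is adapted to it. -/
lemma minSum_growth_odd {h : ℕ} (hs : Splits h) (hs' : Splits (h + 1))
    (hB : B 4 h + 2 ≤ B 4 (h + 1)) : minSum (2 * h + 1) + 6 ≤ minSum (2 * h + 2) := by
  have e2 : (2 * h + 1) / 2 = h := by omega
  have e3 : (2 * h + 1 + 1) / 2 = h + 1 := by omega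
  have e4 : (2 * h + 2) / 2 = h + 1 := by omega
  have e5 : (2 * h + 2 + 1) / 2 = h + 1 := by omega
  have h2 := Splits.cB_add_le_minSum (n := 2 * h + 2) (by rwa [e4]) (by rwa [e5])
  rw [e4, e5] at h2
  have h3 := hs'.K_le_add
  have h4 := cB_growth hB
  have h5 := six_mul_add_le_four_pow (B 4 (h + 1)) (by omega)
  have h6 : 4 ^ 3 ≤ 4 ^ B 4 (h + 1) :=
    Nat.pow_le_pow_right (by norm_num) (by have := hs.one_le_B; omega)
  have h7 : cB 4 (h + 1) = 4 ^ B 4 (h + 1) + 1 := rfl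
  have hj := Nat.mod_lt (K 4 (h + 1)) (show 3 > 0 by norm_num)
  have hK := hs'.attained.K_eq_Ki
  set j := K 4 (h + 1) % 3
  obtain ⟨i, hi, hij⟩ : ∃ i < 3, (i + j) % 3 = 1 := ⟨(4 - j) % 3, by omega, by omega⟩
  have h1 := minSum_le (2 * h + 1) hi hj hij
  have h8 := hs.Ki_lt hi
  rw [e2, e3] at h1
  omega

lemma splits_and_growth (n : ℕ) (hn : 2 ≤ n) :
    Splits n ∧ (3 ≤ n → B 4 (n - 1) + 2 ≤ B 4 n) := by
  induction n using Nat.strong_induction_on with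
  | _ n ih =>
    obtain rfl | rfl | hn4 : n = 2 ∨ n = 3 ∨ 4 ≤ n := by omega
    · exact ⟨splits_two, by omega⟩
    · exact ⟨splits_three, fun _ => by simp [B_two, B_three]⟩
    have hgrow : ∀ p q, 2 ≤ p → p + 1 ≤ q → q < n → B 4 p + 2 ≤ B 4 q := by
      intro p q hp hpq
      induction q, hpq using Nat.le_induction with
      | base =>
        intro hq
        exact (ih (p + 1) hq (by omega)).2 (by omega)
      | succ q hq ih' =>
        intro hqn
        have h1 := ih' (by omega)
        have h2 := (ih (q + 1) hqn (by omega)).2 (by omega)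
        simp only [Nat.add_sub_cancel] at h2
        omega
    have ha := (ih (n / 2) (by omega) (by omega)).1
    have hb := (ih ((n + 1) / 2) (by omega) (by omega)).1
    have hab : cB 4 (n / 2) ≤ cB 4 ((n + 1) / 2) := by
      obtain h | h : (n + 1) / 2 = n / 2 ∨ n / 2 + 1 ≤ (n + 1) / 2 := by omega
      · rw [h]
      · have h1 := cB_growth (hgrow _ _ (by omega) h (by omega))
        have h2 := two_le_cB (n / 2)
        omega
    have hs : Splits n := by
      refine splits_of_attained hn ha.attained hb.attained fun m hbm hmn r hr => ?_
      have h1 := cB_growth (hgrow _ m (by omega) hbm hmn)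
      have h2 : cB 4 m ≤ r := (ih m hmn (by omega)).1.lower r hr
      have h3 := minSum_le n (i := 2) (j := 2) (by norm_num) (by norm_num) (by norm_num)
      have h4 := ha.Ki_lt (i := 2) (by norm_num)
      have h5 := hb.Ki_lt (i := 2) (by norm_num)
      have h6 := two_le_cB ((n + 1) / 2)
      omega
    refine ⟨hs, fun _ => ?_⟩
    have hs' := (ih (n - 1) (by omega) (by omega)).1
    suffices h : minSum (n - 1) + 6 ≤ minSum n by
      have := hs.minSum_add
      have := hs'.minSum_add
      omega
    obtain ⟨h, rfl | rfl⟩ : ∃ h, n = 2 * h + 1 ∨ n = 2 * h + 2 := ⟨(n - 1) / 2, by omega⟩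
    · exact minSum_growth_even (ih h (by omega) (by omega)).1 (ih (h + 1) (by omega) (by omega)).1
        (hgrow h (h + 1) (by omega) le_rfl (by omega))
    -- Index `1` is not covered by `Splits`, so the growth from `3` to `4` is checked numerically.
    · obtain rfl | hh : h = 1 ∨ 2 ≤ h := by omega
      · have := Splits.cB_add_le_minSum (n := 4) splits_two splits_two
        simp only [Nat.reduceDiv, Nat.reduceAdd, Nat.reduceMul, Nat.reduceSub, cB_two,
          minSum_three] at this ⊢
        omega
      · exact minSum_growth_odd (ih h (by omega) (by omega)).1 (ih (h + 1) (by omega) (by omega)).1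
          (hgrow h (h + 1) (by omega) le_rfl (by omega))

lemma splits {n : ℕ} (hn : 2 ≤ n) : Splits n := (splits_and_growth n hn).1

lemma B_add_two_le {p q : ℕ} (hp : 2 ≤ p) (hpq : p < q) : B 4 p + 2 ≤ B 4 q := by
  induction q, hpq using Nat.le_induction with
  | base => exact (splits_and_growth (p + 1) (by omega)).2 (by omega)
  | succ q hq ih =>
    have := (splits_and_growth (q + 1) (by omega)).2 (by omega)
    simp only [Nat.add_sub_cancel] at this
    omega

lemma sixteen_mul_cB_le {p q : ℕ} (hp : 2 ≤ p) (hpq : p < q) : 16 * cB 4 p ≤ cB 4 q + 15 :=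
  cB_growth (B_add_two_le hp hpq)

lemma attained {n : ℕ} (hn : 1 ≤ n) : Attained n := by
  obtain rfl | h : n = 1 ∨ 2 ≤ n := by omega
  exacts [attained_one, (splits h).attained]
/-! ### The three ways of splitting -/

/-- All `K_i(n)` continue with `K_2(⌊n/2⌋)`. -/
structure SplitsTwoTwo (n : ℕ) : Prop where
  zero : Ki 4 0 n = 2 * cB 4 n + Ki 4 2 (n / 2)
  one : Ki 4 1 n = cB 4 n + Ki 4 2 (n / 2)
  two : Ki 4 2 n = 3 * cB 4 n + Ki 4 2 (n / 2)

/-- `K_0(n)` continues with `K_1(q)`, and `K_1(n)` and `K_2(n)` continue with `K_0(p)`. -/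
structure SplitsZeroOne (n p q : ℕ) : Prop where
  zero : Ki 4 0 n = cB 4 n + Ki 4 1 q
  one : Ki 4 1 n = 2 * cB 4 n + Ki 4 0 p
  two : Ki 4 2 n = cB 4 n + Ki 4 0 p

/-- The optimal pair is unique and both its members have residue `2`, so the residue `i` determines
the coefficient and the smaller member is the tail. -/
lemma splitsTwoTwo_of_lt {n : ℕ} (hn : 2 ≤ n)
    (h01 : Ki 4 2 (n / 2) + Ki 4 2 ((n + 1) / 2) < Ki 4 0 (n / 2) + Ki 4 1 ((n + 1) / 2))
    (h10 : Ki 4 2 (n / 2) + Ki 4 2 ((n + 1) / 2) < Ki 4 1 (n / 2) + Ki 4 0 ((n + 1) / 2))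
    (hle : Ki 4 2 (n / 2) ≤ Ki 4 2 ((n + 1) / 2)) : SplitsTwoTwo n := by
  have hs := splits hn
  have hsum : Ki 4 2 (n / 2) + Ki 4 2 ((n + 1) / 2) = minSum n := by unfold minSum; omega
  have ho : IsOptimal n 2 2 := ⟨by norm_num, by norm_num, by norm_num, hsum⟩
  have huniq : ∀ i j, IsOptimal n i j → i = 2 ∧ j = 2 := by
    rintro i j ⟨hi, hj, hij, h⟩
    obtain ⟨rfl, rfl⟩ | ⟨rfl, rfl⟩ | ⟨rfl, rfl⟩ :
      (i = 0 ∧ j = 1) ∨ (i = 1 ∧ j = 0) ∨ (i = 2 ∧ j = 2) := by omega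
    · omega
    · omega
    · exact ⟨rfl, rfl⟩
  have hma := (hs.attained_left.Ki_mem (i := 2) (by norm_num)).2
  have hmb := (hs.attained_right.Ki_mem (i := 2) (by norm_num)).2
  have hA := cB_mod_three n
  have key : ∀ i < 3, ∀ c, 1 ≤ c → c ≤ 3 → (2 * c + 2) % 3 = i →
      Ki 4 i n = c * cB 4 n + Ki 4 2 (n / 2) := by
    intro i hi c hc hc' hci
    have hup : Ki 4 i n ≤ c * cB 4 n + Ki 4 2 (n / 2) := by
      refine Ki_le (hs.F_left hc hc' ho) ?_
      obtain rfl | rfl | rfl : c = 1 ∨ c = 2 ∨ c = 3 := by omega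
      all_goals omega
    have hmod := (hs.attained.Ki_mem hi).2
    obtain ⟨c', i', j', h1, h2, ho', h⟩ := hs.exists_Ki_eq hi
    obtain ⟨rfl, rfl⟩ := huniq i' j' ho'
    obtain rfl : c' = c := by
      obtain rfl | rfl | rfl : c = 1 ∨ c = 2 ∨ c = 3 := by omega
      all_goals
        obtain rfl | rfl | rfl : c' = 1 ∨ c' = 2 ∨ c' = 3 := by omega
        all_goals omega
    omega
  exact ⟨key 0 (by norm_num) 2 (by norm_num) (by norm_num) rfl,
    by simpa using key 1 (by norm_num) 1 (by norm_num) (by norm_num) rfl,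
    key 2 (by norm_num) 3 (by norm_num) (by norm_num) rfl⟩

/-- Coefficients `1, 2, 3` give residues `2, 1, 0` before the tail `K_0(p)` and `0, 2, 1` before
`K_1(q)`. The tails are smaller than the unit, so the smaller coefficient wins. Leaving `p`, `q`
free covers both orders of the halves. -/
lemma splitsZeroOne_of_forall {n p q : ℕ} (hn : 2 ≤ n) (hp : Ki 4 0 p % 3 = 0)
    (hq : Ki 4 1 q % 3 = 1) (hle : Ki 4 0 p + Ki 4 1 q ≤ minSum n)
    (hFp : ∀ c, 1 ≤ c → c ≤ 3 → F 4 (c * cB 4 n + Ki 4 0 p) = n)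
    (hFq : ∀ c, 1 ≤ c → c ≤ 3 → F 4 (c * cB 4 n + Ki 4 1 q) = n)
    (huniq : ∀ i j, IsOptimal n i j → (Ki 4 i (n / 2) = Ki 4 0 p ∨ Ki 4 i (n / 2) = Ki 4 1 q) ∧
      (Ki 4 j ((n + 1) / 2) = Ki 4 0 p ∨ Ki 4 j ((n + 1) / 2) = Ki 4 1 q)) :
    SplitsZeroOne n p q := by
  have hs := splits hn
  have hA := cB_mod_three n
  have hsum := hs.minSum_add
  have h3 := three_mul_lt_four_pow _ hs.one_le_B
  have hA' : cB 4 n = 4 ^ B 4 n + 1 := rfl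
  have key : ∀ i < 3, ∃ c, 1 ≤ c ∧ c ≤ 3 ∧
      (Ki 4 i n = c * cB 4 n + Ki 4 0 p ∨ Ki 4 i n = c * cB 4 n + Ki 4 1 q) := by
    intro i hi
    obtain ⟨c, i', j', h1, h2, ho, h⟩ := hs.exists_Ki_eq hi
    obtain ⟨h4, h5⟩ := huniq i' j' ho
    exact ⟨c, h1, h2, by omega⟩
  have m0 := (hs.attained.Ki_mem (i := 0) (by norm_num)).2
  have m1 := (hs.attained.Ki_mem (i := 1) (by norm_num)).2
  have m2 := (hs.attained.Ki_mem (i := 2) (by norm_num)).2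
  refine ⟨?_, ?_, ?_⟩
  · have hup := Ki_le (hFq 1 (by norm_num) (by norm_num)) (i := 0) (by omega)
    obtain ⟨c, hc, hc', h⟩ := key 0 (by norm_num)
    obtain rfl | rfl | rfl : c = 1 ∨ c = 2 ∨ c = 3 := by omega
    all_goals omega
  · have hup := Ki_le (hFp 2 (by norm_num) (by norm_num)) (i := 1) (by omega)
    obtain ⟨c, hc, hc', h⟩ := key 1 (by norm_num)
    obtain rfl | rfl | rfl : c = 1 ∨ c = 2 ∨ c = 3 := by omega
    all_goals omega
  · have hup := Ki_le (hFp 1 (by norm_num) (by norm_num)) (i := 2) (by omega)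
    obtain ⟨c, hc, hc', h⟩ := key 2 (by norm_num)
    obtain rfl | rfl | rfl : c = 1 ∨ c = 2 ∨ c = 3 := by omega
    all_goals omega

lemma splitsZeroOne_floor {n : ℕ} (hn : 2 ≤ n)
    (h10 : Ki 4 0 (n / 2) + Ki 4 1 ((n + 1) / 2) < Ki 4 1 (n / 2) + Ki 4 0 ((n + 1) / 2) ∨
      (n + 1) / 2 = n / 2)
    (h22 : Ki 4 0 (n / 2) + Ki 4 1 ((n + 1) / 2) < Ki 4 2 (n / 2) + Ki 4 2 ((n + 1) / 2)) :
    SplitsZeroOne n (n / 2) ((n + 1) / 2) := by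
  have hs := splits hn
  have hsum : Ki 4 0 (n / 2) + Ki 4 1 ((n + 1) / 2) = minSum n := by
    unfold minSum
    rcases h10 with h10 | h10
    · omega
    · rw [h10] at h22 ⊢
      omega
  have ho : IsOptimal n 0 1 := ⟨by norm_num, by norm_num, by norm_num, hsum⟩
  refine splitsZeroOne_of_forall hn (hs.attained_left.Ki_mem (by norm_num)).2
    (hs.attained_right.Ki_mem (by norm_num)).2 hsum.le (fun c hc hc' => hs.F_left hc hc' ho)
    (fun c hc hc' => hs.F_right hc hc' ho) ?_
  rintro i j ⟨hi, hj, hij, h⟩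
  obtain ⟨rfl, rfl⟩ | ⟨rfl, rfl⟩ | ⟨rfl, rfl⟩ :
    (i = 0 ∧ j = 1) ∨ (i = 1 ∧ j = 0) ∨ (i = 2 ∧ j = 2) := by omega
  · exact ⟨Or.inl rfl, Or.inr rfl⟩
  · rcases h10 with h10 | h10
    · omega
    -- For even `n` the pairs `(0, 1)` and `(1, 0)` are the same splitting.
    · rw [h10]
      exact ⟨Or.inr rfl, Or.inl rfl⟩
  · omega

lemma splitsZeroOne_ceil {n : ℕ} (hn : 2 ≤ n)
    (h01 : Ki 4 1 (n / 2) + Ki 4 0 ((n + 1) / 2) < Ki 4 0 (n / 2) + Ki 4 1 ((n + 1) / 2))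
    (h22 : Ki 4 1 (n / 2) + Ki 4 0 ((n + 1) / 2) < Ki 4 2 (n / 2) + Ki 4 2 ((n + 1) / 2)) :
    SplitsZeroOne n ((n + 1) / 2) (n / 2) := by
  have hs := splits hn
  have hsum : Ki 4 1 (n / 2) + Ki 4 0 ((n + 1) / 2) = minSum n := by unfold minSum; omega
  have ho : IsOptimal n 1 0 := ⟨by norm_num, by norm_num, by norm_num, hsum⟩
  refine splitsZeroOne_of_forall hn (hs.attained_right.Ki_mem (by norm_num)).2
    (hs.attained_left.Ki_mem (by norm_num)).2 (by omega) (fun c hc hc' => hs.F_right hc hc' ho)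
    (fun c hc hc' => hs.F_left hc hc' ho) ?_
  rintro i j ⟨hi, hj, hij, h⟩
  obtain ⟨rfl, rfl⟩ | ⟨rfl, rfl⟩ | ⟨rfl, rfl⟩ :
    (i = 0 ∧ j = 1) ∨ (i = 1 ∧ j = 0) ∨ (i = 2 ∧ j = 2) := by omega
  · omega
  · exact ⟨Or.inr rfl, Or.inl rfl⟩
  · omega

/-- The index `3` fits neither pattern: `0 + 19` and `2 + 17` are both minimal, so four tails
compete. -/
lemma Ki_three :
    Ki 4 0 3 = cB 4 3 + 19 ∧ Ki 4 1 3 = cB 4 3 + 2 ∧ Ki 4 2 3 = cB 4 3 := by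
  have hs := splits_three
  have e := minSum_three
  have h0 := Ki_zero_one
  have h1 := Ki_one_one
  have h2 := Ki_two_one
  have g0 := Ki_two 0 (by norm_num)
  have g1 := Ki_two 1 (by norm_num)
  have g2 := Ki_two 2 (by norm_num)
  norm_num at g0 g1 g2
  have o0 : IsOptimal 3 0 1 := ⟨by norm_num, by norm_num, by norm_num, by simp [e, h0, g1]⟩
  have o2 : IsOptimal 3 2 2 := ⟨by norm_num, by norm_num, by norm_num, by simp [e, h2, g2]⟩
  have f0 := hs.F_left le_rfl (by norm_num) o0
  have f1 := hs.F_right le_rfl (by norm_num) o0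
  have f2 := hs.F_left le_rfl (by norm_num) o2
  simp only [Nat.reduceDiv, Nat.reduceAdd, h0, h2, g1, one_mul, add_zero] at f0 f1 f2
  have hA := cB_mod_three 3
  have hA' : 20 ≤ cB 4 3 := by rw [cB_three]; norm_num
  have key : ∀ i < 3, ∃ c r, 1 ≤ c ∧ c ≤ 3 ∧ (r = 0 ∨ r = 2 ∨ r = 17 ∨ r = 19) ∧
      Ki 4 i 3 = c * cB 4 3 + r := by
    intro i hi
    obtain ⟨c, i', j', hc, hc', ⟨hi', hj', hij, hsum⟩, h⟩ := hs.exists_Ki_eq hi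
    simp only [Nat.reduceDiv, Nat.reduceAdd] at h hsum
    obtain ⟨rfl, rfl⟩ | ⟨rfl, rfl⟩ | ⟨rfl, rfl⟩ :
      (i' = 0 ∧ j' = 1) ∨ (i' = 1 ∧ j' = 0) ∨ (i' = 2 ∧ j' = 2) := by omega
    · rw [h0, g1] at h
      rcases h with h | h
      exacts [⟨c, 0, hc, hc', by norm_num, h⟩, ⟨c, 19, hc, hc', by norm_num, h⟩]
    · omega
    · rw [h2, g2] at h
      rcases h with h | h
      exacts [⟨c, 2, hc, hc', by norm_num, h⟩, ⟨c, 17, hc, hc', by norm_num, h⟩]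
  have m0 := (hs.attained.Ki_mem (i := 0) (by norm_num)).2
  have m1 := (hs.attained.Ki_mem (i := 1) (by norm_num)).2
  have m2 := (hs.attained.Ki_mem (i := 2) (by norm_num)).2
  refine ⟨?_, ?_, ?_⟩
  · have := Ki_le f1 (i := 0) (by omega)
    obtain ⟨c, r, hc, hc', hr, h⟩ := key 0 (by norm_num)
    obtain rfl | rfl | rfl : c = 1 ∨ c = 2 ∨ c = 3 := by omega
    all_goals omega
  · have := Ki_le f2 (i := 1) (by omega)
    obtain ⟨c, r, hc, hc', hr, h⟩ := key 1 (by norm_num)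
    obtain rfl | rfl | rfl : c = 1 ∨ c = 2 ∨ c = 3 := by omega
    all_goals omega
  · have := Ki_le f0 (i := 2) (by omega)
    obtain ⟨c, r, hc, hc', hr, h⟩ := key 2 (by norm_num)
    obtain rfl | rfl | rfl : c = 1 ∨ c = 2 ∨ c = 3 := by omega
    all_goals omega

/-! ### Which splitting occurs -/

lemma cB_le_Ki {n i : ℕ} (hn : 2 ≤ n) (hi : i < 3) : cB 4 n ≤ Ki 4 i n := (splits hn).cB_le_Ki hi

lemma Ki_add_four_le {n i : ℕ} (hn : 2 ≤ n) (hi : i < 3) : Ki 4 i n + 4 ≤ 4 * cB 4 n :=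
  (splits hn).Ki_lt hi

lemma Ki_lt_cB {m n i : ℕ} (hm : 2 ≤ m) (hmn : m < n) (hi : i < 3) : 4 * Ki 4 i m < cB 4 n := by
  have := Ki_add_four_le hm hi
  have := sixteen_mul_cB_le hm hmn
  omega

lemma Ki_lt_Ki {m n i j : ℕ} (hm : 2 ≤ m) (hmn : m < n) (hi : i < 3) (hj : j < 3) :
    Ki 4 i m < Ki 4 j n := by
  have := Ki_lt_cB hm hmn hi
  have := cB_le_Ki (by omega : 2 ≤ n) hj
  omega

/-- For odd `n`, `K_0` and `K_2` of the larger half share the coefficient `1`; the smaller half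
decides, where `K_2` has coefficient `1` and `K_1` has `2`. The bounds on `p` and `p'` keep the
remaining tails below that unit. -/
lemma splitsTwoTwo_of_halves {n p q p' q' : ℕ} (hn : 14 ≤ n)
    (ha : SplitsZeroOne (n / 2) p q) (hb : SplitsZeroOne ((n + 1) / 2) p' q')
    (hp : 2 ≤ p) (hpn : p < n / 2) (hp' : 2 ≤ p') (hpn' : p' < n / 2) : SplitsTwoTwo n := by
  have h1 := Ki_lt_cB (i := 0) hp hpn (by norm_num)
  have h2 := Ki_lt_cB (i := 0) hp' hpn' (by norm_num)
  obtain ⟨a0, a1, a2⟩ := ha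
  obtain ⟨b0, b1, b2⟩ := hb
  obtain h | h : (n + 1) / 2 = n / 2 ∨ n / 2 < (n + 1) / 2 := by omega
  · rw [h] at b0 b1 b2
    refine splitsTwoTwo_of_lt (by omega) ?_ ?_ ?_ <;> rw [h] <;> omega
  · have h3 := Ki_lt_Ki (i := 2) (j := 2) (by omega) h (by norm_num) (by norm_num)
    have h4 := Ki_lt_cB (i := 2) (by omega) h (by norm_num)
    exact splitsTwoTwo_of_lt (by omega) (by omega) (by omega) h3.le

lemma splitsTwoTwo_four : SplitsTwoTwo 4 := by
  refine splitsTwoTwo_of_lt (by norm_num) ?_ ?_ ?_ <;> norm_num [Ki_two]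

lemma splitsTwoTwo_five : SplitsTwoTwo 5 := by
  obtain ⟨h0, h1, h2⟩ := Ki_three
  have hA : 20 ≤ cB 4 3 := by rw [cB_three]; norm_num
  refine splitsTwoTwo_of_lt (by norm_num) ?_ ?_ ?_ <;> norm_num [Ki_two, h0, h1, h2] <;> omega

lemma splitsTwoTwo_six : SplitsTwoTwo 6 := by
  obtain ⟨h0, h1, h2⟩ := Ki_three
  refine splitsTwoTwo_of_lt (by norm_num) ?_ ?_ ?_ <;> norm_num [h0, h1, h2] <;> omega

/-- The way in which the numbers `K_i(n)` split, for all `n ≥ 4`. -/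
lemma splitting_pattern (n d : ℕ) :
    (10 * 4 ^ d + 2 ≤ 3 * n → 3 * n < 20 * 4 ^ d + 1 → SplitsTwoTwo n) ∧
    (20 * 4 ^ d + 1 ≤ 3 * n → 3 * n + 1 < 10 * 4 ^ (d + 1) →
      SplitsZeroOne n (n / 2) ((n + 1) / 2)) ∧
    (3 * n + 1 = 10 * 4 ^ (d + 1) → SplitsZeroOne n ((n + 1) / 2) (n / 2)) := by
  induction n using Nat.strong_induction_on generalizing d with
  | _ n ih =>
    have hd : 1 ≤ 4 ^ d := Nat.one_le_pow _ _ (by norm_num)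
    have hd3 : 4 ^ d % 3 = 1 := by simp [Nat.pow_mod]
    refine ⟨fun hl hr => ?_, fun hl hr => ?_, fun he => ?_⟩
    · rcases d with _ | e
      · obtain rfl | rfl | rfl : n = 4 ∨ n = 5 ∨ n = 6 := by omega
        exacts [splitsTwoTwo_four, splitsTwoTwo_five, splitsTwoTwo_six]
      · have he : 1 ≤ 4 ^ e := Nat.one_le_pow _ _ (by norm_num)
        -- Both halves lie in the second range for `e` or at its block end.
        have hhalf : ∀ h < n, 20 * 4 ^ e + 1 ≤ 3 * h → 3 * h + 1 ≤ 10 * 4 ^ (e + 1) →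
            ∃ p q, SplitsZeroOne h p q ∧ h / 2 ≤ p ∧ p ≤ (h + 1) / 2 := by
          intro h hn h1 h2
          rcases h2.lt_or_eq with h2 | h2
          · exact ⟨_, _, (ih h hn e).2.1 h1 h2, by omega, by omega⟩
          · exact ⟨_, _, (ih h hn e).2.2 h2, by omega, by omega⟩
        have he3 : 4 ^ e % 3 = 1 := by simp [Nat.pow_mod]
        rw [pow_succ] at *
        obtain ⟨p, q, ha, hp, hp'⟩ := hhalf (n / 2) (by omega) (by omega) (by omega)
        obtain ⟨p', q', hb, hq, hq'⟩ := hhalf ((n + 1) / 2) (by omega) (by omega) (by omega)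
        exact splitsTwoTwo_of_halves (by omega) ha hb (by omega) (by omega) (by omega) (by omega)
    · rw [pow_succ] at hr
      -- Only the upper half need lie in the first range: for odd `n` its coefficients decide.
      have hb := (ih ((n + 1) / 2) (by omega) d).1 (by omega) (by omega)
      have hbc := two_le_cB ((n + 1) / 2)
      obtain ⟨b0, b1, b2⟩ := hb
      obtain h | h : (n + 1) / 2 = n / 2 ∨ n / 2 < (n + 1) / 2 := by omega
      · refine splitsZeroOne_floor (by omega) (Or.inr h) ?_
        rw [h] at b0 b1 b2 hbc ⊢
        omega
      · have h0 := Ki_lt_cB (i := 0) (by omega) h (by norm_num)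
        exact splitsZeroOne_floor (by omega) (Or.inl (by omega)) (by omega)
    · rw [pow_succ] at he
      -- The halves straddle the boundary of the ranges. The upper one leaves `(1, 0)` and `(2, 2)`
      -- tied, and the lower one favours `K_1` over `K_2`.
      have ha := (ih (n / 2) (by omega) d).1 (by omega) (by omega)
      have hb := (ih ((n + 1) / 2) (by omega) d).2.1 (by omega) (by rw [pow_succ]; omega)
      obtain ⟨a0, a1, a2⟩ := ha
      obtain ⟨b0, b1, b2⟩ := hb
      have h1 := Ki_lt_cB (i := 1) (show 2 ≤ n / 2 by omega) (show n / 2 < (n + 1) / 2 by omega)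
        (by norm_num)
      have h2 := Ki_lt_cB (i := 1) (show 2 ≤ ((n + 1) / 2 + 1) / 2 by omega)
        (show ((n + 1) / 2 + 1) / 2 < n / 2 by omega) (by norm_num)
      exact splitsZeroOne_ceil (by omega) (by omega) (by omega)
/-! ### Quasi-positional expansions -/

lemma mem_idx_four {i : ℕ} : i ∈ idx 4 ↔ i < 3 := by
  have : ¬ Odd 4 := by decide
  simp [idx, this]

lemma Ki_mem_OB_one {i : ℕ} (hi : i < 3) : Ki 4 i 1 ∈ OB 4 1 :=
  ⟨[], i, ⟨by simp, mem_idx_four.2 hi, List.IsChain.nil, by simp⟩, rfl, by simp [repValue]⟩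

lemma add_mem_OB_of_one {c n i : ℕ} (hc : 1 ≤ c) (hc' : c ≤ 3) (hn : n = 2 ∨ n = 3) (hi : i < 3) :
    c * cB 4 n + Ki 4 i 1 ∈ OB 4 n := by
  have : Even 4 := by decide
  refine ⟨[(c, n)], i, ⟨?_, mem_idx_four.2 hi, List.IsChain.singleton _, ?_⟩, rfl, ?_⟩
  · simp [this, hc, hc']
  · simpa using hn
  · simp [repValue]

lemma add_mem_OB {c n m r : ℕ} (hc : 1 ≤ c) (hc' : c ≤ 3) (hm : 2 ≤ m) (hmn : m < n)
    (hhalf : m = n / 2 ∨ m = (n + 1) / 2) (hr : r ∈ OB 4 m) : c * cB 4 n + r ∈ OB 4 n := by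
  have he : Even 4 := by decide
  obtain ⟨L, β, hL, hlead, rfl⟩ := hr
  rcases L with _ | ⟨p, L⟩
  · simp only [leadIndex] at hlead
    omega
  obtain ⟨h1, h2, h3, h4⟩ := hL
  simp only [leadIndex] at hlead
  refine ⟨(c, n) :: p :: L, β, ⟨?_, h2, ?_, ?_⟩, rfl, ?_⟩
  · intro q hq
    rcases List.mem_cons.1 hq with rfl | hq
    · simp [he, hc, hc']
    · exact h1 q hq
  · refine List.IsChain.cons_cons ?_ h3
    simp only [hlead]
    exact ⟨hmn, hhalf⟩
  · rw [List.getLast?_cons_cons]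
    exact h4
  · simp [repValue]
    ring

lemma Ki_mem_OB {n i : ℕ} (hn : 1 ≤ n) (hi : i < 3) : Ki 4 i n ∈ OB 4 n := by
  induction n using Nat.strong_induction_on generalizing i with
  | _ n ih =>
    obtain rfl | hn2 : n = 1 ∨ 2 ≤ n := by omega
    · exact Ki_mem_OB_one hi
    have key : ∀ c m j, 1 ≤ c → c ≤ 3 → (m = n / 2 ∨ m = (n + 1) / 2) → j < 3 →
        c * cB 4 n + Ki 4 j m ∈ OB 4 n := by
      intro c m j hc hc' hm hj
      obtain rfl | hm2 : m = 1 ∨ 2 ≤ m := by omega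
      · exact add_mem_OB_of_one hc hc' (by omega) hj
      · exact add_mem_OB hc hc' hm2 (by omega) hm (ih m (by omega) (by omega) hj)
    obtain ⟨c, a, b, hc, hc', ho, h | h⟩ := (splits hn2).exists_Ki_eq hi
    · rw [h]
      exact key c _ a hc hc' (Or.inl rfl) ho.left_lt
    · rw [h]
      exact key c _ b hc hc' (Or.inr rfl) ho.right_lt

lemma hasLeadingTerms_of_eq {u a n a' n' m j i : ℕ} (hu : u = a * cB 4 n + Ki 4 j n')
    (hj : Ki 4 j n' = a' * cB 4 n' + Ki 4 i m) (hm : 1 ≤ m) (hi : i < 3) :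
    HasLeadingTerms 4 u a n a' n' m :=
  ⟨_, Ki_mem_OB hm hi, by rw [hu, hj, add_assoc]⟩

/-! ### The generalized Thue–Morse sequence -/

lemma tau_eq {n t : ℕ} (hn : 1 ≤ n) (ht : t < 3) (hle : ∀ i < 3, Ki 4 t n ≤ Ki 4 i n) :
    tau 4 n = t := by
  have ha := attained hn
  have he : Even 4 := by decide
  have hK : K 4 n = Ki 4 t n :=
    le_antisymm (K_le (ha.Ki_mem ht).1) (by
      rw [ha.K_eq_Ki]
      exact hle _ (Nat.mod_lt _ (by norm_num)))
  have hset : {t : ℕ | if Even 4 then t ∈ idx 4 ∧ K 4 n = Ki 4 t n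
      else 2 * t ∈ idx 4 ∧ K 4 n = Ki 4 (2 * t) n} = {t} := by
    ext s
    simp only [he, if_true, Set.mem_ofPred_eq, Set.mem_singleton_iff, mem_idx_four]
    constructor
    · rintro ⟨hs, h⟩
      have h1 := (ha.Ki_mem hs).2
      have h2 := (ha.Ki_mem ht).2
      rw [← h, hK] at h1
      omega
    · rintro rfl
      exact ⟨ht, hK⟩
  rw [tau, hset, csInf_singleton]

lemma tau_eq_one {n d : ℕ} (hl : 10 * 4 ^ d + 2 ≤ 3 * n) (hr : 3 * n < 20 * 4 ^ d + 1) :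
    tau 4 n = 1 := by
  obtain ⟨h0, h1, h2⟩ := (splitting_pattern n d).1 hl hr
  refine tau_eq (by omega) (by norm_num) fun i hi => ?_
  obtain rfl | rfl | rfl : i = 0 ∨ i = 1 ∨ i = 2 := by omega
  all_goals omega

/-- `K_0(n)` and `K_2(n)` tie in the leading term; for odd `n` the tail of `K_2(n)` belongs to the
smaller half. -/
lemma tau_eq_two {n d : ℕ} (hl : 20 * 4 ^ d + 1 ≤ 3 * n) (hr : 3 * n + 1 < 10 * 4 ^ (d + 1))
    (hn : Odd n) : tau 4 n = 2 := by
  obtain ⟨h0, h1, h2⟩ := (splitting_pattern n d).2.1 hl hr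
  have hd : 1 ≤ 4 ^ d := Nat.one_le_pow _ _ (by norm_num)
  rw [Nat.odd_iff] at hn
  have := Ki_lt_Ki (i := 0) (j := 1) (show 2 ≤ n / 2 by omega)
    (show n / 2 < (n + 1) / 2 by omega) (by norm_num) (by norm_num)
  refine tau_eq (by omega) (by norm_num) fun i hi => ?_
  obtain rfl | rfl | rfl : i = 0 ∨ i = 1 ∨ i = 2 := by omega
  all_goals omega

lemma tau_eq_zero_of_even {n d : ℕ} (hl : 20 * 4 ^ d + 1 ≤ 3 * n)
    (hr : 3 * n + 1 < 10 * 4 ^ (d + 1)) (hn : Even n) : tau 4 n = 0 := by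
  obtain ⟨h0, h1, h2⟩ := (splitting_pattern n d).2.1 hl hr
  have hd : 1 ≤ 4 ^ d := Nat.one_le_pow _ _ (by norm_num)
  have hd3 : 4 ^ d % 3 = 1 := by simp [Nat.pow_mod]
  rw [Nat.even_iff] at hn
  rw [show (n + 1) / 2 = n / 2 by omega] at h0
  rw [pow_succ] at hr
  -- Both tails now have index `n / 2`, in the first range, where `K_1` is below `K_0`.
  obtain ⟨g0, g1, g2⟩ := (splitting_pattern (n / 2) d).1 (by omega) (by omega)
  refine tau_eq (by omega) (by norm_num) fun i hi => ?_
  obtain rfl | rfl | rfl : i = 0 ∨ i = 1 ∨ i = 2 := by omega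
  all_goals omega

lemma tau_eq_zero_of_eq {n d : ℕ} (he : 3 * n + 1 = 10 * 4 ^ (d + 1)) : tau 4 n = 0 := by
  obtain ⟨h0, h1, h2⟩ := (splitting_pattern n d).2.2 he
  have hd : 1 ≤ 4 ^ d := Nat.one_le_pow _ _ (by norm_num)
  rw [pow_succ] at he
  have := Ki_lt_Ki (i := 1) (j := 0) (show 2 ≤ n / 2 by omega)
    (show n / 2 < (n + 1) / 2 by omega) (by norm_num) (by norm_num)
  refine tau_eq (by omega) (by norm_num) fun i hi => ?_
  obtain rfl | rfl | rfl : i = 0 ∨ i = 1 ∨ i = 2 := by omega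
  all_goals omega

lemma tau_one : tau 4 1 = 0 :=
  tau_eq le_rfl (by norm_num) fun i _ => by simp [Ki_zero_one]

lemma tau_two : tau 4 2 = 2 := by
  refine tau_eq (by norm_num) (by norm_num) fun i hi => ?_
  rw [Ki_two i hi, Ki_two 2 (by norm_num)]
  omega

lemma tau_three : tau 4 3 = 2 := by
  obtain ⟨h0, h1, h2⟩ := Ki_three
  refine tau_eq (by norm_num) (by norm_num) fun i hi => ?_
  obtain rfl | rfl | rfl : i = 0 ∨ i = 1 ∨ i = 2 := by omega
  all_goals omega

lemma three_mul_delta (j : ℕ) : 3 * delta j + 1 = 10 * 4 ^ j := by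
  have : 4 ^ j % 3 = 1 := by simp [Nat.pow_mod]
  unfold delta
  omega

lemma map_range'_eq_replicate {g : ℕ → ℕ} {s k x : ℕ} (h : ∀ i < k, g (s + i) = x) :
    (List.range' s k).map g = List.replicate k x := by
  rw [List.eq_replicate_iff]
  refine ⟨by simp, fun y hy => ?_⟩
  obtain ⟨n, hn, rfl⟩ := List.mem_map.1 hy
  rw [List.mem_range'_1] at hn
  rw [← h (n - s) (by omega), Nat.add_sub_cancel' hn.1]

lemma map_range'_eq_flatten {g : ℕ → ℕ} {s k x y : ℕ}
    (h : ∀ i < k, g (s + 2 * i) = x ∧ g (s + 2 * i + 1) = y) :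
    (List.range' s (2 * k)).map g = (List.replicate k [x, y]).flatten := by
  induction k generalizing s with
  | zero => simp
  | succ k ih =>
    have h0 := h 0 (by omega)
    rw [show 2 * (k + 1) = 2 * k + 1 + 1 by ring, List.range'_succ, List.range'_succ,
      List.replicate_succ, List.flatten_cons, List.map_cons, List.map_cons,
      ih fun i hi => ?_]
    · simp at h0
      simp [h0]
    · have := h (i + 1) (by omega)
      rwa [show s + 1 + 1 + 2 * i = s + 2 * (i + 1) by ring]

lemma map_tau_block (j : ℕ) :
    (List.range' (1 + delta j) (delta j + 2 * delta j + 1)).map (tau 4) = block j := by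
  have hδ := three_mul_delta j
  have hp : 4 ^ (j + 1) = 4 * 4 ^ j := by rw [pow_succ, mul_comm]
  -- The second range starts at `1 + 2 * delta j`; together with `delta (j + 1) = 4 * delta j + 1`,
  -- parity is tracked along the pairs `2, 0`.
  have hmod : delta j % 2 = 1 := by
    have : 10 * 4 ^ j % 2 = 0 := by omega
    omega
  rw [← List.range'_append_1, ← List.range'_append_1, List.map_append, List.map_append, block]
  congr 1
  · congr 1
    · exact map_range'_eq_replicate fun i hi => tau_eq_one (d := j) (by omega) (by omega)
    · refine map_range'_eq_flatten fun i hi => ⟨?_, ?_⟩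
      · exact tau_eq_two (d := j) (by omega) (by omega) (Nat.odd_iff.2 (by omega))
      · exact tau_eq_zero_of_even (d := j) (by omega) (by omega) (Nat.even_iff.2 (by omega))
  · simp only [List.range'_one, List.map_cons, List.map_nil]
    rw [tau_eq_zero_of_eq (d := j) (by omega)]

lemma map_tau_range' (j : ℕ) : (List.range' 1 (delta j)).map (tau 4) =
    [0, 2, 2] ++ (List.range j).flatMap block := by
  induction j with
  | zero => simp [delta, List.range'_succ, tau_one, tau_two, tau_three]
  | succ j ih =>
    have h0 := three_mul_delta j
    have h1 := three_mul_delta (j + 1)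
    rw [pow_succ] at h1
    rw [show delta (j + 1) = delta j + (delta j + 2 * delta j + 1) by omega,
      ← List.range'_append_1, List.map_append, ih, map_tau_block, List.range_succ,
      List.flatMap_append, List.append_assoc]
    simp

/-! ### Leading terms -/

lemma hasLeadingTerms_first_range {d n : ℕ} (hl : 10 * 4 ^ d + 2 ≤ 3 * n)
    (hr : 3 * n < 20 * 4 ^ d + 1) :
    ∃ m, m = (if 1 ≤ d ∧ 3 * n + 2 = 20 * 4 ^ d then (n + 3) / 4 else n / 4) ∧
      HasLeadingTerms 4 (Ki 4 0 n) 2 n 1 (n / 2) m ∧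
      HasLeadingTerms 4 (Ki 4 1 n) 1 n 1 (n / 2) m ∧
      HasLeadingTerms 4 (Ki 4 2 n) 3 n 1 (n / 2) m := by
  obtain ⟨h0, h1, h2⟩ := (splitting_pattern n d).1 hl hr
  refine ⟨_, rfl, ?_⟩
  set m := if 1 ≤ d ∧ 3 * n + 2 = 20 * 4 ^ d then (n + 3) / 4 else n / 4 with hm
  have hd : 1 ≤ 4 ^ d := Nat.one_le_pow _ _ (by norm_num)
  have hm1 : 1 ≤ m := by
    rw [hm]
    split_ifs <;> omega
  have key : Ki 4 2 (n / 2) = 1 * cB 4 (n / 2) + Ki 4 0 m := by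
    rw [one_mul]
    rcases d with _ | e
    · rw [if_neg (by omega)] at hm
      rw [pow_zero] at hl hr
      rw [show m = 1 by omega, Ki_zero_one]
      obtain h | h : n / 2 = 2 ∨ n / 2 = 3 := by omega
      · rw [h, Ki_two 2 (by norm_num), cB_two]
      · rw [h, Ki_three.2.2, add_zero]
    · have he3 : 4 ^ e % 3 = 1 := by simp [Nat.pow_mod]
      have hp : 4 ^ (e + 1) = 4 * 4 ^ e := by rw [pow_succ, mul_comm]
      -- In this case `n / 2` is a block end, where the tail of `K_2` takes the upper half.
      by_cases h : 3 * n + 2 = 20 * 4 ^ (e + 1)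
      · rw [if_pos ⟨by omega, h⟩] at hm
        rw [((splitting_pattern (n / 2) e).2.2 (by omega)).two, hm]
        congr 2
        omega
      · rw [if_neg (by omega)] at hm
        rw [((splitting_pattern (n / 2) e).2.1 (by omega) (by omega)).two, hm]
        congr 2
        omega
  exact ⟨hasLeadingTerms_of_eq h0 key hm1 (by norm_num),
    hasLeadingTerms_of_eq (by rw [h1, one_mul]) key hm1 (by norm_num),
    hasLeadingTerms_of_eq h2 key hm1 (by norm_num)⟩

lemma hasLeadingTerms_second_range {d n : ℕ} (hl : 20 * 4 ^ d + 1 ≤ 3 * n)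
    (hr : 3 * n + 1 < 10 * 4 ^ (d + 1)) :
    ∃ a m, a = (if 3 * n = 20 * 4 ^ d + 1 then 1 else 2) ∧
      m = (if n = 7 then 2 else n / 4) ∧
      HasLeadingTerms 4 (Ki 4 0 n) 1 n 1 ((n + 1) / 2) ((n + 1) / 4) ∧
      HasLeadingTerms 4 (Ki 4 1 n) 2 n a (n / 2) m ∧
      HasLeadingTerms 4 (Ki 4 2 n) 1 n a (n / 2) m := by
  obtain ⟨h0, h1, h2⟩ := (splitting_pattern n d).2.1 hl hr
  refine ⟨_, _, rfl, rfl, ?_⟩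
  set a := if 3 * n = 20 * 4 ^ d + 1 then 1 else 2 with ha
  set m := if n = 7 then 2 else n / 4 with hm
  have hd : 1 ≤ 4 ^ d := Nat.one_le_pow _ _ (by norm_num)
  have hd3 : 4 ^ d % 3 = 1 := by simp [Nat.pow_mod]
  have hp : 4 ^ (d + 1) = 4 * 4 ^ d := by rw [pow_succ, mul_comm]
  have hm1 : 1 ≤ m := by
    rw [hm]
    split_ifs <;> omega
  have key0 : Ki 4 1 ((n + 1) / 2) = 1 * cB 4 ((n + 1) / 2) + Ki 4 2 ((n + 1) / 4) := by
    rw [((splitting_pattern ((n + 1) / 2) d).1 (by omega) (by omega)).one, one_mul]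
    congr 2
    omega
  have key : ∃ i < 3, Ki 4 0 (n / 2) = a * cB 4 (n / 2) + Ki 4 i m := by
    -- Here `n / 2` is the end of the previous block, or `3` when `n = 7`, so `K_0(n / 2)` has
    -- coefficient `1` instead of `2`. For `n = 7` the tail is `19 = K_1(2)`.
    by_cases h : 3 * n = 20 * 4 ^ d + 1
    · rw [if_pos h] at ha
      refine ⟨1, by norm_num, ?_⟩
      rw [ha, one_mul]
      rcases d with _ | e
      · obtain rfl : n = 7 := by omega
        rw [hm, if_pos rfl, Ki_two 1 (by norm_num), show 7 / 2 = 3 from rfl, Ki_three.1]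
      · have he : 1 ≤ 4 ^ e := Nat.one_le_pow _ _ (by norm_num)
        have hp' : 4 ^ (e + 1) = 4 * 4 ^ e := by rw [pow_succ, mul_comm]
        rw [if_neg (by omega)] at hm
        rw [((splitting_pattern (n / 2) e).2.2 (by omega)).zero, hm]
        congr 2
        omega
    · have h7 : n ≠ 7 := by
        rintro rfl
        omega
      rw [if_neg h] at ha
      rw [if_neg h7] at hm
      refine ⟨2, by norm_num, ?_⟩
      rw [((splitting_pattern (n / 2) d).1 (by omega) (by omega)).zero, hm, ha]
      congr 2
      omega
  obtain ⟨i, hi, key⟩ := key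
  exact ⟨hasLeadingTerms_of_eq (by rw [h0, one_mul]) key0 (by omega) (by norm_num),
    hasLeadingTerms_of_eq h1 key hm1 hi,
    hasLeadingTerms_of_eq (by rw [h2, one_mul]) key hm1 hi⟩

lemma hasLeadingTerms_block_end {d n : ℕ} (he : 3 * n + 1 = 10 * 4 ^ (d + 1)) :
    HasLeadingTerms 4 (Ki 4 0 n) 1 n 1 (n / 2) (n / 4) ∧
      HasLeadingTerms 4 (Ki 4 1 n) 2 n 1 ((n + 1) / 2) ((n + 3) / 4) ∧
      HasLeadingTerms 4 (Ki 4 2 n) 1 n 1 ((n + 1) / 2) ((n + 3) / 4) := by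
  obtain ⟨h0, h1, h2⟩ := (splitting_pattern n d).2.2 he
  have hd : 1 ≤ 4 ^ d := Nat.one_le_pow _ _ (by norm_num)
  have hd3 : 4 ^ d % 3 = 1 := by simp [Nat.pow_mod]
  have hp : 4 ^ (d + 1) = 4 * 4 ^ d := by rw [pow_succ, mul_comm]
  have key0 : Ki 4 1 (n / 2) = 1 * cB 4 (n / 2) + Ki 4 2 (n / 4) := by
    rw [((splitting_pattern (n / 2) d).1 (by omega) (by omega)).one, one_mul]
    congr 2
    omega
  have key : Ki 4 0 ((n + 1) / 2) = 1 * cB 4 ((n + 1) / 2) + Ki 4 1 ((n + 3) / 4) := by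
    rw [((splitting_pattern ((n + 1) / 2) d).2.1 (by omega) (by omega)).zero, one_mul]
    congr 2
    omega
  exact ⟨hasLeadingTerms_of_eq (by rw [h0, one_mul]) key0 (by omega) (by norm_num),
    hasLeadingTerms_of_eq h1 key (by omega) (by norm_num),
    hasLeadingTerms_of_eq (by rw [h2, one_mul]) key (by omega) (by norm_num)⟩

end Kaprekar

open Kaprekar in
/-- All bounds on `n` are multiplied by `3`; `(n + 1) / 2` and `(n + 3) / 4` are
`⌈n/2⌉` and `⌈n/4⌉`. -/
theorem mainTheorem5 :
    (∀ d n : ℕ,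
      -- first range
      (10 * 4 ^ d + 2 ≤ 3 * n → 3 * n < 20 * 4 ^ d + 1 →
        (∃ m, m = (if 1 ≤ d ∧ 3 * n + 2 = 20 * 4 ^ d then (n + 3) / 4 else n / 4) ∧
          HasLeadingTerms 4 (Ki 4 0 n) 2 n 1 (n / 2) m ∧
          HasLeadingTerms 4 (Ki 4 1 n) 1 n 1 (n / 2) m ∧
          HasLeadingTerms 4 (Ki 4 2 n) 3 n 1 (n / 2) m) ∧
        tau 4 n = 1) ∧
      -- second range
      (20 * 4 ^ d + 1 ≤ 3 * n → 3 * n + 1 < 10 * 4 ^ (d + 1) →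
        (∃ a m, a = (if 3 * n = 20 * 4 ^ d + 1 then 1 else 2) ∧
          m = (if n = 7 then 2 else n / 4) ∧
          HasLeadingTerms 4 (Ki 4 0 n) 1 n 1 ((n + 1) / 2) ((n + 1) / 4) ∧
          HasLeadingTerms 4 (Ki 4 1 n) 2 n a (n / 2) m ∧
          HasLeadingTerms 4 (Ki 4 2 n) 1 n a (n / 2) m) ∧
        (Odd n → tau 4 n = 2) ∧ (Even n → tau 4 n = 0)) ∧
      -- the single value that ends the block
      (3 * n + 1 = 10 * 4 ^ (d + 1) →
        HasLeadingTerms 4 (Ki 4 0 n) 1 n 1 (n / 2) (n / 4) ∧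
        HasLeadingTerms 4 (Ki 4 1 n) 2 n 1 ((n + 1) / 2) ((n + 3) / 4) ∧
        HasLeadingTerms 4 (Ki 4 2 n) 1 n 1 ((n + 1) / 2) ((n + 3) / 4) ∧
        tau 4 n = 0)) ∧
    -- the terms of index `1, …, δ_j`, for every `j`
    (∀ j : ℕ, (List.range' 1 (delta j)).map (tau 4) =
      [0, 2, 2] ++ (List.range j).flatMap block) := by
  exact ⟨fun d n => ⟨fun hl hr => ⟨hasLeadingTerms_first_range hl hr, tau_eq_one hl hr⟩,
    fun hl hr => ⟨hasLeadingTerms_second_range hl hr, tau_eq_two hl hr, tau_eq_zero_of_even hl hr⟩,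
    fun he => ⟨(hasLeadingTerms_block_end he).1, (hasLeadingTerms_block_end he).2.1,
      (hasLeadingTerms_block_end he).2.2, tau_eq_zero_of_eq he⟩⟩, map_tau_range'⟩
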